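/- **Theorem 1.** All graphs are finite, simple and undirected. For a set $D$ of vertices of a graph $G$ and vertices $u,v$ of $G$, let $\mathrm{dist}_{(G,D)}(u,v)$ be the minimum length of a path $P$ in $G$ between $u$ and $v$ such that $D$ contains exactly one endvertex of $P$ but no internal vertex of $P$, and let $\mathrm{dist}_{(G,D)}(u,v)=\infty$ if there is no such path. (If $u=v$, then $P$ is the path of length $0$, whose only endvertex is $u$.) The set $D$ is an exponential dominating set of $G$ if $\sum_{v\in D}\left(\frac12\right)^{\mathrm{dist}_{(G,D)}(u,v)-1}\ge 1$ for every vertex $u$ of $G$, where $\left(\frac12\right)^{\infty}=0$; and $D$ is a dominating set of $G$ if every vertex of $G$ not in $D$ has a neighbor in $D$. Let $\gamma_e(G)$ and $\gamma(G)$ be the minimum order of an exponential dominating set and of a dominating set of $G$, respectively. A graph is $\mathcal F$-free if none of its induced subgraphs is isomorphic to a member of $\mathcal F$. Let $P_n$, $C_n$, $K_n$ be the path, cycle and complete graph of order $n$, let $\Box$ denote the Cartesian product, let $K_{2,3}$ be the complete bipartite graph with parts of order $2$ and $3$, and define: - the bull: a triangle with one pendant vertex attached to each of two of its vertices; - the diamond: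 $K_4$ minus one edge; - $F_1$: a path of order $3$ with one pendant vertex attached to each of its three vertices; - $F_2$: obtained from a $4$-cycle and a disjoint path of order $3$ by adding an edge between a vertex of the cycle and an endvertex of the path; - $F_3$: the union of a $4$-cycle and a $5$-cycle that share exactly one edge and its two ends; - $F_4$: the union of two $4$-cycles that share exactly one vertex; - $F_5$: obtained from a $4$-cycle $abcd$ by adding a path $a\,e\,f\,c$ with two new internal vertices $e,f$ and a new vertex $g$ adjacent only to $b$. Let $G$ be a $\{\text{bull},\text{diamond},K_4,K_{2,3},P_2\,\Box\,P_3\}$-free graph. Then $\gamma(H)=\gamma_e(H)$ holds for every induced subgraph $H$ of $G$ if and only if $G$ is $\{P_7,C_7,F_1,F_2,F_3,F_4,F_5\}$-free. -/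

import Mathlib

/-- `D` is a dominating set of `G`: every vertex outside `D` has a neighbor in `D`. -/
def IsDominatingSet {V : Type*} (G : SimpleGraph V) (D : Finset V) : Prop :=
  ∀ u : V, u ∉ D → ∃ v ∈ D, G.Adj u v

/-- The domination number: the minimum order of a dominating set of a finite graph. -/
noncomputable def dominationNumber {V : Type*} (G : SimpleGraph V) : ℕ :=
  sInf {n : ℕ | ∃ D : Finset V, IsDominatingSet G D ∧ D.card = n}

/-- The walk `p` from `u` to `v` is a path such that `D` contains exactly one endvertex of `p`
and no internal vertex of `p`. -/
def IsAdmissiblePath {V : Type*} {G : SimpleGraph V} (D : Finset V) {u v : V}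
    (p : G.Walk u v) : Prop :=
  p.IsPath ∧ (∃! x : V, (x = u ∨ x = v) ∧ x ∈ D) ∧
    ∀ x ∈ p.support, x ≠ u → x ≠ v → x ∉ D

/-- The minimum length of an admissible path between `u` and `v`; it is `⊤` if there is none. -/
noncomputable def blockedDist {V : Type*} (G : SimpleGraph V) (D : Finset V) (u v : V) : ℕ∞ :=
  ⨅ (p : G.Walk u v) (_ : IsAdmissiblePath D p), (p.length : ℕ∞)

open scoped Classical in
/-- `(1/2) ^ (d - 1)`, with the convention that it is `0` for `d = ∞`. -/
noncomputable def expDecay (d : ℕ∞) : ℝ :=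
  if d = ⊤ then 0 else (1 / 2 : ℝ) ^ ((d.toNat : ℤ) - 1)

/-- The weight that the vertex `u` receives from the set `D`. -/
noncomputable def expWeight {V : Type*} (G : SimpleGraph V) (D : Finset V) (u : V) : ℝ :=
  ∑ v ∈ D, expDecay (blockedDist G D u v)

/-- `D` is an exponential dominating set of `G`. -/
def IsExpDominatingSet {V : Type*} (G : SimpleGraph V) (D : Finset V) : Prop :=
  ∀ u : V, 1 ≤ expWeight G D u

/-- The exponential domination number: the minimum order of an exponential dominating set of a
finite graph. -/
noncomputable def expDominationNumber {V : Type*} (G : SimpleGraph V) : ℕ :=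
  sInf {n : ℕ | ∃ D : Finset V, IsExpDominatingSet G D ∧ D.card = n}

/-- `G` is `H`-free: no induced subgraph of `G` is isomorphic to `H`. -/
def InducedFree {V W : Type*} (H : SimpleGraph W) (G : SimpleGraph V) : Prop :=
  ¬ H.IsIndContained G

/-- The bull: a triangle `0 1 2` with pendant vertices `3` at `0` and `4` at `1`. -/
def bullGraph : SimpleGraph (Fin 5) :=
  SimpleGraph.fromEdgeSet {s(0, 1), s(0, 2), s(1, 2), s(0, 3), s(1, 4)}

/-- The diamond: `K₄` minus the edge between `2` and `3`. -/
def diamondGraph : SimpleGraph (Fin 4) :=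
  SimpleGraph.fromEdgeSet {s(0, 1), s(0, 2), s(1, 2), s(0, 3), s(1, 3)}

/-- `F₁`: the path `0 1 2` with one pendant vertex attached to each of its vertices. -/
def graphF1 : SimpleGraph (Fin 6) :=
  SimpleGraph.fromEdgeSet {s(0, 1), s(1, 2), s(0, 3), s(1, 4), s(2, 5)}

/-- `F₂`: the 4-cycle `0 1 2 3` and a path `0 4 5 6` starting on it. -/
def graphF2 : SimpleGraph (Fin 7) :=
  SimpleGraph.fromEdgeSet
    {s(0, 1), s(1, 2), s(2, 3), s(3, 0), s(0, 4), s(4, 5), s(5, 6)}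

/-- `F₃`: the 4-cycle `0 1 2 3` and the 5-cycle `0 4 5 6 1`, sharing exactly the edge `0 1`. -/
def graphF3 : SimpleGraph (Fin 7) :=
  SimpleGraph.fromEdgeSet
    {s(0, 1), s(1, 2), s(2, 3), s(3, 0), s(0, 4), s(4, 5), s(5, 6), s(6, 1)}

/-- `F₄`: the 4-cycles `0 1 2 3` and `0 4 5 6`, sharing exactly the vertex `0`. -/
def graphF4 : SimpleGraph (Fin 7) :=
  SimpleGraph.fromEdgeSet
    {s(0, 1), s(1, 2), s(2, 3), s(3, 0), s(0, 4), s(4, 5), s(5, 6), s(6, 0)}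

/-- `F₅`: the 4-cycle `0 1 2 3`, a path `0 4 5 2` between the opposite vertices `0` and `2`, and a
pendant vertex `6` attached to `1`. -/
def graphF5 : SimpleGraph (Fin 7) :=
  SimpleGraph.fromEdgeSet
    {s(0, 1), s(1, 2), s(2, 3), s(3, 0), s(0, 4), s(4, 5), s(5, 2), s(1, 6)}

/-!
The theorem reduces to one structural fact: a connected graph in the restricted class has a
dominating set with at most two vertices (`IsForbiddenFree.exists_dominating_pair`).

From this, `γ ≤ γₑ` follows component by component
(`IsForbiddenFree.exists_component_dominating`). No weight passes between components, so an
exponential dominating set `D` meets each of them. If `D` meets a component in a single vertex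
`d`, every vertex of the component receives weight at least `1` from `d` alone, hence is at
distance at most `1` from `d`, and `d` dominates the component. If `D` meets a component in two
or more vertices, two dominating vertices of the component cost no more than `D` does. The
inequality `γₑ ≤ γ` holds in every graph.

The structural fact is proved by induction. Delete a vertex `v` whose removal keeps the graph
connected; the rest is dominated by some `a` and `b`. If no pair of vertices dominates the whole
graph (`IsCritical`), then `v` is adjacent to neither `a` nor `b`, it has a neighbor `w` in the
neighborhood of, say, `a`, and `a`, `b` are adjacent, have a common neighbor, or are the ends of
an induced path with three edges. In each case the vertices named so far are dominated by some pair
of them; that pair misses a further vertex, which is adjacent to `a` or `b`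
(`IsCritical.exists_undominated`). The forbidden subgraphs leave few possible neighborhoods for
the new vertex, and after at most four such steps they leave none.

For the converse, each of `P₇`, `C₇`, `F₁`, …, `F₅` has no dominating pair, but it has a pair
`p`, `q` such that every other vertex is adjacent to one of them or at distance two from both,
and then receives weight at least `1/2 + 1/2` (`inducedFree_of_forall_induce_eq`).
-/

open SimpleGraph

section

universe u

variable {V : Type u} {G : SimpleGraph V}

/-! ### Forbidden induced subgraphs on named vertices -/

/-- To refute `H`-freeness it suffices to give a map that preserves and reflects adjacency and
separates the false twins of `H`: vertices of `H` with different neighborhoods cannot have the same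
image. -/
theorem InducedFree.elim {V W : Type*} {H : SimpleGraph W} {G : SimpleGraph V}
    (h : InducedFree H G) (f : W → V) (hadj : ∀ i j, G.Adj (f i) (f j) ↔ H.Adj i j)
    (htwin : ∀ i j, i ≠ j → (∀ k, H.Adj i k ↔ H.Adj j k) → f i ≠ f j) : False :=
  h ⟨⟨⟨f, fun i j hij => by_contra fun hne =>
    htwin i j hne (fun k => by rw [← hadj, ← hadj, hij]) hij⟩, fun {i j} => hadj i j⟩⟩

/-- The graphs `G` that contain none of the listed graphs as an induced subgraph. The domino is
the ladder `P₂ □ P₃`. For each listed graph, the theorem below with the corresponding name states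
its absence for explicitly named vertices, in the vertex order of its definition. -/
structure IsForbiddenFree {V : Type*} (G : SimpleGraph V) : Prop where
  bull_free : InducedFree bullGraph G
  diamond_free : InducedFree diamondGraph G
  k23_free : InducedFree (completeBipartiteGraph (Fin 2) (Fin 3)) G
  domino_free : InducedFree ((pathGraph 2).boxProd (pathGraph 3)) G
  p7_free : InducedFree (pathGraph 7) G
  c7_free : InducedFree (cycleGraph 7) G
  f1_free : InducedFree graphF1 G
  f2_free : InducedFree graphF2 G
  f3_free : InducedFree graphF3 G
  f4_free : InducedFree graphF4 G

theorem IsForbiddenFree.bull (h : IsForbiddenFree G) (x₀ x₁ x₂ x₃ x₄ : V) (_ : G.Adj x₀ x₁)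
    (_ : G.Adj x₀ x₂) (_ : G.Adj x₁ x₂) (_ : G.Adj x₀ x₃) (_ : G.Adj x₁ x₄) (_ : ¬G.Adj x₀ x₄)
    (_ : ¬G.Adj x₁ x₃) (_ : ¬G.Adj x₂ x₃) (_ : ¬G.Adj x₂ x₄) (_ : ¬G.Adj x₃ x₄) : False := by
  refine h.bull_free.elim ![x₀, x₁, x₂, x₃, x₄] ?_ ?_
  · simp_all [Fin.forall_fin_succ, G.adj_comm, bullGraph]
  · simp [Fin.forall_fin_succ, bullGraph]

theorem IsForbiddenFree.diamond (h : IsForbiddenFree G) (x₀ x₁ x₂ x₃ : V) (_ : G.Adj x₀ x₁)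
    (_ : G.Adj x₀ x₂) (_ : G.Adj x₁ x₂) (_ : G.Adj x₀ x₃) (_ : G.Adj x₁ x₃) (_ : ¬G.Adj x₂ x₃)
    (_ : x₂ ≠ x₃) : False := by
  refine h.diamond_free.elim ![x₀, x₁, x₂, x₃] ?_ ?_
  · simp_all [Fin.forall_fin_succ, G.adj_comm, diamondGraph]
  · simp [Fin.forall_fin_succ, diamondGraph]; grind

theorem IsForbiddenFree.k23 (h : IsForbiddenFree G) (x₀ x₁ x₂ x₃ x₄ : V) (_ : G.Adj x₀ x₂)
    (_ : G.Adj x₀ x₃) (_ : G.Adj x₀ x₄) (_ : G.Adj x₁ x₂) (_ : G.Adj x₁ x₃) (_ : G.Adj x₁ x₄)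
    (_ : ¬G.Adj x₀ x₁) (_ : ¬G.Adj x₂ x₃) (_ : ¬G.Adj x₂ x₄) (_ : ¬G.Adj x₃ x₄) (_ : x₀ ≠ x₁)
    (_ : x₂ ≠ x₃) (_ : x₂ ≠ x₄) (_ : x₃ ≠ x₄) : False := by
  refine h.k23_free.elim (Sum.elim ![x₀, x₁] ![x₂, x₃, x₄]) ?_ ?_
  · simp_all [Fin.forall_fin_succ, G.adj_comm, Sum.forall]
  · simp [Sum.forall, Fin.forall_fin_succ]; grind

theorem IsForbiddenFree.domino (h : IsForbiddenFree G) (x₀ x₁ x₂ x₃ x₄ x₅ : V) (_ : G.Adj x₀ x₁)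
    (_ : G.Adj x₁ x₂) (_ : G.Adj x₃ x₄) (_ : G.Adj x₄ x₅) (_ : G.Adj x₀ x₃) (_ : G.Adj x₁ x₄)
    (_ : G.Adj x₂ x₅) (_ : ¬G.Adj x₀ x₂) (_ : ¬G.Adj x₀ x₄) (_ : ¬G.Adj x₀ x₅) (_ : ¬G.Adj x₁ x₃)
    (_ : ¬G.Adj x₁ x₅) (_ : ¬G.Adj x₂ x₃) (_ : ¬G.Adj x₂ x₄) (_ : ¬G.Adj x₃ x₅) : False := by
  refine h.domino_free.elim (fun i => ![![x₀, x₁, x₂], ![x₃, x₄, x₅]] i.1 i.2) ?_ ?_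
  · simp_all [Fin.forall_fin_succ, G.adj_comm, pathGraph_adj]
  · simp [Fin.forall_fin_succ, pathGraph_adj]

theorem IsForbiddenFree.f1 (h : IsForbiddenFree G) (x₀ x₁ x₂ x₃ x₄ x₅ : V) (_ : G.Adj x₀ x₁)
    (_ : G.Adj x₁ x₂) (_ : G.Adj x₀ x₃) (_ : G.Adj x₁ x₄) (_ : G.Adj x₂ x₅) (_ : ¬G.Adj x₀ x₂)
    (_ : ¬G.Adj x₀ x₄) (_ : ¬G.Adj x₀ x₅) (_ : ¬G.Adj x₁ x₃) (_ : ¬G.Adj x₁ x₅) (_ : ¬G.Adj x₂ x₃)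
    (_ : ¬G.Adj x₂ x₄) (_ : ¬G.Adj x₃ x₄) (_ : ¬G.Adj x₃ x₅) (_ : ¬G.Adj x₄ x₅) : False := by
  refine h.f1_free.elim ![x₀, x₁, x₂, x₃, x₄, x₅] ?_ ?_
  · simp_all [Fin.forall_fin_succ, G.adj_comm, graphF1]
  · simp [Fin.forall_fin_succ, graphF1]

theorem IsForbiddenFree.p7 (h : IsForbiddenFree G) (x₀ x₁ x₂ x₃ x₄ x₅ x₆ : V) (_ : G.Adj x₀ x₁)
    (_ : G.Adj x₁ x₂) (_ : G.Adj x₂ x₃) (_ : G.Adj x₃ x₄) (_ : G.Adj x₄ x₅) (_ : G.Adj x₅ x₆)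
    (_ : ¬G.Adj x₀ x₂) (_ : ¬G.Adj x₀ x₃) (_ : ¬G.Adj x₀ x₄) (_ : ¬G.Adj x₀ x₅) (_ : ¬G.Adj x₀ x₆)
    (_ : ¬G.Adj x₁ x₃) (_ : ¬G.Adj x₁ x₄) (_ : ¬G.Adj x₁ x₅) (_ : ¬G.Adj x₁ x₆) (_ : ¬G.Adj x₂ x₄)
    (_ : ¬G.Adj x₂ x₅) (_ : ¬G.Adj x₂ x₆) (_ : ¬G.Adj x₃ x₅) (_ : ¬G.Adj x₃ x₆) (_ : ¬G.Adj x₄ x₆)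
    : False := by
  refine h.p7_free.elim ![x₀, x₁, x₂, x₃, x₄, x₅, x₆] ?_ ?_
  · simp_all [Fin.forall_fin_succ, G.adj_comm, pathGraph_adj]
  · simp [Fin.forall_fin_succ, pathGraph_adj]

theorem IsForbiddenFree.c7 (h : IsForbiddenFree G) (x₀ x₁ x₂ x₃ x₄ x₅ x₆ : V) (_ : G.Adj x₀ x₁)
    (_ : G.Adj x₁ x₂) (_ : G.Adj x₂ x₃) (_ : G.Adj x₃ x₄) (_ : G.Adj x₄ x₅) (_ : G.Adj x₅ x₆)
    (_ : G.Adj x₆ x₀) (_ : ¬G.Adj x₀ x₂) (_ : ¬G.Adj x₀ x₃) (_ : ¬G.Adj x₀ x₄) (_ : ¬G.Adj x₀ x₅)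
    (_ : ¬G.Adj x₁ x₃) (_ : ¬G.Adj x₁ x₄) (_ : ¬G.Adj x₁ x₅) (_ : ¬G.Adj x₁ x₆) (_ : ¬G.Adj x₂ x₄)
    (_ : ¬G.Adj x₂ x₅) (_ : ¬G.Adj x₂ x₆) (_ : ¬G.Adj x₃ x₅) (_ : ¬G.Adj x₃ x₆) (_ : ¬G.Adj x₄ x₆)
    : False := by
  refine h.c7_free.elim ![x₀, x₁, x₂, x₃, x₄, x₅, x₆] ?_ ?_
  · simp_all +decide [Fin.forall_fin_succ, G.adj_comm, cycleGraph_adj']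
  · simp +decide [Fin.forall_fin_succ, cycleGraph_adj']

theorem IsForbiddenFree.f2 (h : IsForbiddenFree G) (x₀ x₁ x₂ x₃ x₄ x₅ x₆ : V) (_ : G.Adj x₀ x₁)
    (_ : G.Adj x₁ x₂) (_ : G.Adj x₂ x₃) (_ : G.Adj x₃ x₀) (_ : G.Adj x₀ x₄) (_ : G.Adj x₄ x₅)
    (_ : G.Adj x₅ x₆) (_ : ¬G.Adj x₀ x₂) (_ : ¬G.Adj x₀ x₅) (_ : ¬G.Adj x₀ x₆) (_ : ¬G.Adj x₁ x₃)
    (_ : ¬G.Adj x₁ x₄) (_ : ¬G.Adj x₁ x₅) (_ : ¬G.Adj x₁ x₆) (_ : ¬G.Adj x₂ x₄) (_ : ¬G.Adj x₂ x₅)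
    (_ : ¬G.Adj x₂ x₆) (_ : ¬G.Adj x₃ x₄) (_ : ¬G.Adj x₃ x₅) (_ : ¬G.Adj x₃ x₆) (_ : ¬G.Adj x₄ x₆)
    (_ : x₁ ≠ x₃) : False := by
  refine h.f2_free.elim ![x₀, x₁, x₂, x₃, x₄, x₅, x₆] ?_ ?_
  · simp_all [Fin.forall_fin_succ, G.adj_comm, graphF2]
  · simp [Fin.forall_fin_succ, graphF2]; grind

theorem IsForbiddenFree.f3 (h : IsForbiddenFree G) (x₀ x₁ x₂ x₃ x₄ x₅ x₆ : V) (_ : G.Adj x₀ x₁)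
    (_ : G.Adj x₁ x₂) (_ : G.Adj x₂ x₃) (_ : G.Adj x₃ x₀) (_ : G.Adj x₀ x₄) (_ : G.Adj x₄ x₅)
    (_ : G.Adj x₅ x₆) (_ : G.Adj x₆ x₁) (_ : ¬G.Adj x₀ x₂) (_ : ¬G.Adj x₀ x₅) (_ : ¬G.Adj x₀ x₆)
    (_ : ¬G.Adj x₁ x₃) (_ : ¬G.Adj x₁ x₄) (_ : ¬G.Adj x₁ x₅) (_ : ¬G.Adj x₂ x₄) (_ : ¬G.Adj x₂ x₅)
    (_ : ¬G.Adj x₂ x₆) (_ : ¬G.Adj x₃ x₄) (_ : ¬G.Adj x₃ x₅) (_ : ¬G.Adj x₃ x₆) (_ : ¬G.Adj x₄ x₆)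
    : False := by
  refine h.f3_free.elim ![x₀, x₁, x₂, x₃, x₄, x₅, x₆] ?_ ?_
  · simp_all [Fin.forall_fin_succ, G.adj_comm, graphF3]
  · simp [Fin.forall_fin_succ, graphF3]

theorem IsForbiddenFree.f4 (h : IsForbiddenFree G) (x₀ x₁ x₂ x₃ x₄ x₅ x₆ : V) (_ : G.Adj x₀ x₁)
    (_ : G.Adj x₁ x₂) (_ : G.Adj x₂ x₃) (_ : G.Adj x₃ x₀) (_ : G.Adj x₀ x₄) (_ : G.Adj x₄ x₅)
    (_ : G.Adj x₅ x₆) (_ : G.Adj x₆ x₀) (_ : ¬G.Adj x₀ x₂) (_ : ¬G.Adj x₀ x₅) (_ : ¬G.Adj x₁ x₃)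
    (_ : ¬G.Adj x₁ x₄) (_ : ¬G.Adj x₁ x₅) (_ : ¬G.Adj x₁ x₆) (_ : ¬G.Adj x₂ x₄) (_ : ¬G.Adj x₂ x₅)
    (_ : ¬G.Adj x₂ x₆) (_ : ¬G.Adj x₃ x₄) (_ : ¬G.Adj x₃ x₅) (_ : ¬G.Adj x₃ x₆) (_ : ¬G.Adj x₄ x₆)
    (_ : x₁ ≠ x₃) (_ : x₄ ≠ x₆) : False := by
  refine h.f4_free.elim ![x₀, x₁, x₂, x₃, x₄, x₅, x₆] ?_ ?_
  · simp_all [Fin.forall_fin_succ, G.adj_comm, graphF4]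
  · simp [Fin.forall_fin_succ, graphF4]; grind

/-! ### Adding undominated vertices to a critical configuration -/

/-- `G` lies in the class and no pair of vertices dominates it, but the distinct vertices `a` and `b`
dominate every vertex except `v`. -/
structure IsCritical (G : SimpleGraph V) (a b v : V) : Prop extends IsForbiddenFree G where
  ne : a ≠ b ∧ a ≠ v ∧ b ≠ v
  not_adj_left : ¬G.Adj a v
  not_adj_right : ¬G.Adj b v
  dominates : ∀ u, u = a ∨ u = b ∨ u = v ∨ G.Adj a u ∨ G.Adj b u
  undominated : ∀ p q, ∃ z, z ≠ p ∧ z ≠ q ∧ ¬G.Adj p z ∧ ¬G.Adj q z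

/-- When `p` and `q` dominate all the vertices named so far, this yields a new vertex, and the
second part says that the new vertex is adjacent to `a` or `b`. In the lemmas below, each step is
followed by the instances of forbidden subgraphs that exclude all other neighborhoods of the new
vertex. -/
theorem IsCritical.exists_undominated {a b v : V} (h : IsCritical G a b v) (p q : V) :
    ∃ z, (z ≠ p ∧ z ≠ q ∧ ¬G.Adj p z ∧ ¬G.Adj q z) ∧
      (z = a ∨ z = b ∨ z = v ∨ G.Adj a z ∨ G.Adj b z) :=
  (h.undominated p q).imp fun z hz => ⟨hz, h.dominates z⟩

/-- `v w a x b` is an induced path. -/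
theorem IsCritical.false_of_five_path {a b v w x : V} (h : IsCritical G a b v)
    (_ : ¬G.Adj a b) (_ : G.Adj a w)
    (_ : G.Adj a x) (_ : ¬G.Adj b w) (_ : G.Adj b x) (_ : G.Adj v w) (_ : ¬G.Adj v x)
    (_ : ¬G.Adj w x) : False := by
  have := h.not_adj_left
  have := h.not_adj_right
  have := h.ne
  obtain ⟨y, hy⟩ := h.exists_undominated b w
  have := h.bull a x y w b
  have := h.f1 w a x v y b
  have : G.Adj a y ∧ ¬G.Adj b y ∧ G.Adj v y ∧ ¬G.Adj w y ∧ ¬G.Adj x y := by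
    grind +splitImp [G.adj_comm]
  obtain ⟨z, hz⟩ := h.exists_undominated v x
  have := h.k23 w y a v z
  have := h.f4 a w v y x b z
  have := h.f2 a w v y x b z
  have := h.bull a y z x v
  have := h.f3 a y v w x b z
  have := h.bull a w z x v
  have := h.f3 a w v y x b z
  have := h.f1 w a x v z b
  grind +splitImp [G.adj_comm]

/-- `a w v x` is an induced `4`-cycle and `b` is a pendant vertex at `x`. -/
theorem IsCritical.false_of_square_pendant {a b v w x : V} (h : IsCritical G a b v)
    (_ : ¬G.Adj a b) (_ : G.Adj a w)
    (_ : G.Adj a x) (_ : ¬G.Adj b w) (_ : G.Adj b x) (_ : G.Adj v w) (_ : G.Adj v x)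
    (_ : ¬G.Adj w x) : False := by
  have := h.not_adj_left
  have := h.not_adj_right
  have := h.ne
  obtain ⟨y, hy⟩ := h.exists_undominated b w
  have := h.k23 a v w x y
  have := h.bull a x y w b
  have : G.Adj a y ∧ ¬G.Adj b y ∧ ¬G.Adj v y ∧ ¬G.Adj w y ∧ ¬G.Adj x y := by
    grind +splitImp [G.adj_comm]
  obtain ⟨z, hz⟩ := h.exists_undominated a x
  have := h.domino v w z x a y
  have := h.domino a x b w v z
  have := h.bull w z v a b
  have := h.f1 a x b y v z
  have := h.f3 a x v w y z b
  grind +splitImp [G.adj_comm]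

/-- `v w a y x b` is an induced path. -/
theorem IsCritical.false_of_six_path {a b v w x y : V} (h : IsCritical G a b v) (_ : ¬G.Adj a b)
    (_ : G.Adj a w) (_ : ¬G.Adj a x) (_ : G.Adj a y) (_ : ¬G.Adj b w) (_ : G.Adj b x)
    (_ : ¬G.Adj b y) (_ : G.Adj v w) (_ : ¬G.Adj v x) (_ : ¬G.Adj v y) (_ : ¬G.Adj w x)
    (_ : ¬G.Adj w y) (_ : G.Adj x y) : False := by
  have := h.not_adj_left
  have := h.not_adj_right
  have := h.ne
  obtain ⟨z, hz⟩ := h.exists_undominated w x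
  have := h.c7 a w v z b x y
  have := h.f3 a z v w y x b
  have := h.f1 w a y v z x
  have := h.f2 a w v z y x b
  have := h.bull a y z w x
  have := h.f3 y z b x a w v
  have := h.p7 v w a y x b z
  have := h.f2 y x b z a w v
  grind +splitImp [G.adj_comm]

/-- `a w v y` is an induced `4`-cycle and the path `y x b` is attached at `y`. -/
theorem IsCritical.false_of_square_tail {a b v w x y : V} (h : IsCritical G a b v) (_ : ¬G.Adj a b)
    (_ : G.Adj a w) (_ : ¬G.Adj a x) (_ : G.Adj a y) (_ : ¬G.Adj b w) (_ : G.Adj b x)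
    (_ : ¬G.Adj b y) (_ : G.Adj v w) (_ : ¬G.Adj v x) (_ : G.Adj v y) (_ : ¬G.Adj w x)
    (_ : ¬G.Adj w y) (_ : G.Adj x y) : False := by
  have := h.not_adj_left
  have := h.not_adj_right
  have := h.ne
  obtain ⟨z, hz⟩ := h.exists_undominated w x
  have := h.k23 a v w y z
  have := h.f3 v y a w z b x
  have := h.f3 a y v w z b x
  have := h.bull a y z w x
  have := h.bull v y z w x
  have := h.f2 y a w v x b z
  have := h.f4 y a w v x b z
  have := h.f1 a y x z v b
  grind +splitImp [G.adj_comm]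

/-- `a w v x y` is an induced `5`-cycle and `b` is a pendant vertex at `x`. -/
theorem IsCritical.false_of_pentagon_pendant {a b v w x y : V} (h : IsCritical G a b v)
    (_ : ¬G.Adj a b)
    (_ : G.Adj a w) (_ : ¬G.Adj a x) (_ : G.Adj a y) (_ : ¬G.Adj b w) (_ : G.Adj b x)
    (_ : ¬G.Adj b y) (_ : G.Adj v w) (_ : G.Adj v x) (_ : ¬G.Adj v y) (_ : ¬G.Adj w x)
    (_ : ¬G.Adj w y) (_ : G.Adj x y) : False := by
  have := h.not_adj_left
  have := h.not_adj_right
  have := h.ne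
  obtain ⟨z, hz⟩ := h.exists_undominated a x
  have := h.k23 x z b v y
  have := h.domino a y x w z b
  have := h.f3 v x b z w a y
  have := h.bull v w z x a
  have := h.f1 b x y z v a
  have := h.f3 x y z b v w a
  grind +splitImp [G.adj_comm]

/-- `v w y x` is an induced `4`-cycle, `a` forms a triangle with its edge `w y`, and `b` is a
pendant vertex at `x`. -/
theorem IsCritical.false_of_house_pendant {a b v w x y : V} (h : IsCritical G a b v)
    (_ : ¬G.Adj a b)
    (_ : G.Adj a w) (_ : ¬G.Adj a x) (_ : G.Adj a y) (_ : ¬G.Adj b w) (_ : G.Adj b x)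
    (_ : ¬G.Adj b y) (_ : G.Adj v w) (_ : G.Adj v x) (_ : ¬G.Adj v y) (_ : ¬G.Adj w x)
    (_ : G.Adj w y) (_ : G.Adj x y) : False := by
  have := h.not_adj_left
  have := h.not_adj_right
  have := h.ne
  obtain ⟨z, hz⟩ := h.exists_undominated b w
  have := h.diamond a y w z
  have := h.bull v x z w b
  have := h.bull a y w z x
  have := h.bull a w y z v
  grind +splitImp [G.adj_comm]

/-- `a w x b` is an induced path and `v` is a pendant vertex at `w`. -/
theorem IsCritical.false_of_path_pendant {a b v w x : V} (h : IsCritical G a b v)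
    (_ : ¬G.Adj a b) (_ : G.Adj a w)
    (_ : ¬G.Adj a x) (_ : ¬G.Adj b w) (_ : G.Adj b x) (_ : G.Adj v w) (_ : ¬G.Adj v x)
    (_ : G.Adj w x) : False := by
  have := h.not_adj_left
  have := h.not_adj_right
  have := h.ne
  obtain ⟨y, hy⟩ := h.exists_undominated b w
  have := h.k23 w y a v x
  have := h.f1 a w x y v b
  have : (G.Adj a y ∧ ¬G.Adj b y ∧ G.Adj v y ∧ ¬G.Adj w y ∧ ¬G.Adj x y) ∨ (G.Adj a y ∧ ¬G.Adj b y ∧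
      ¬G.Adj v y ∧ ¬G.Adj w y ∧ G.Adj x y) := by
    grind +splitImp [G.adj_comm]
  rcases this with this | this
  · obtain ⟨z, hz⟩ := h.exists_undominated x y
    have := h.k23 a v w y z
    have := h.bull a w z y x
    have := h.f3 v w a y z b x
    have := h.f3 a w v y z b x
    have := h.bull v w z y x
    have := h.f2 w a y v x b z
    have := h.f4 w a y v x b z
    have := h.f1 a w x z v b
    grind +splitImp [G.adj_comm]
  · obtain ⟨z, hz⟩ := h.exists_undominated w x
    have := h.domino v w x z a y
    have := h.f3 w x y a v z b
    have := h.f1 b x w z y v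
    have := h.bull y z a x v
    have := h.f1 a w x z v b
    have := h.domino a y z w x b
    have := h.bull a z y w b
    grind +splitImp [G.adj_comm]

/-- `a`, `b` and `v` are pairwise nonadjacent neighbors of `w`. -/
theorem IsCritical.false_of_claw {a b v w : V} (h : IsCritical G a b v)
    (_ : ¬G.Adj a b) (_ : G.Adj a w)
    (_ : G.Adj b w) (_ : G.Adj v w) : False := by
  have := h.not_adj_left
  have := h.not_adj_right
  have := h.ne
  obtain ⟨x, hx⟩ := h.exists_undominated a w
  have : (¬G.Adj a x ∧ G.Adj b x ∧ ¬G.Adj v x ∧ ¬G.Adj w x) ∨ (¬G.Adj a x ∧ G.Adj b x ∧ G.Adj v x ∧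
      ¬G.Adj w x) := by
    grind +splitImp [G.adj_comm]
  rcases this with this | this
  · obtain ⟨y, hy⟩ := h.exists_undominated b w
    have := h.f1 a w b y v x
    have : (G.Adj a y ∧ ¬G.Adj b y ∧ G.Adj v y ∧ ¬G.Adj w y ∧ ¬G.Adj x y) ∨ (G.Adj a y ∧
        ¬G.Adj b y ∧ ¬G.Adj v y ∧ ¬G.Adj w y ∧ G.Adj x y) ∨ (G.Adj a y ∧ ¬G.Adj b y ∧ G.Adj v y ∧
        ¬G.Adj w y ∧ G.Adj x y) := by
      grind +splitImp [G.adj_comm]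
    rcases this with this | this | this
    · obtain ⟨z, hz⟩ := h.exists_undominated b y
      have := h.bull a w z y b
      have := h.k23 a v w y z
      have := h.f3 a w v y z x b
      have := h.f1 a w b z v x
      grind +splitImp [G.adj_comm]
    · obtain ⟨z, hz⟩ := h.exists_undominated w x
      have := h.k23 w z a b v
      have := h.f3 b w v z x y a
      have := h.f3 a w v z y x b
      have := h.bull a y z w x
      have := h.domino v z y w b x
      have := h.f1 w b x v z y
      have := h.f1 a w b z v x
      have : ¬G.Adj a z ∧ G.Adj b z ∧ ¬G.Adj v z ∧ ¬G.Adj w z ∧ ¬G.Adj x z ∧ G.Adj y z := by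
        grind +splitImp [G.adj_comm]
      obtain ⟨s, hs⟩ := h.exists_undominated w y
      have := h.k23 y s a x z
      have := h.k23 w s a b v
      have := h.f1 w a y v s x
      have := h.bull b x s w y
      have := h.f3 a w v s y x b
      have := h.domino a y z s x b
      have := h.f3 b w v s x y a
      have := h.f1 a w b y v s
      grind +splitImp [G.adj_comm]
    · obtain ⟨z, hz⟩ := h.exists_undominated b y
      have := h.bull a w z y b
      have := h.k23 a v w y z
      have := h.domino v y x w a z
      have := h.f1 a y x z v b
      grind +splitImp [G.adj_comm]
  · obtain ⟨y, hy⟩ := h.exists_undominated a x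
    have := h.bull b w y x a
    have := h.k23 b v w x y
    have : ¬G.Adj a y ∧ G.Adj b y ∧ ¬G.Adj v y ∧ ¬G.Adj w y ∧ ¬G.Adj x y := by
      grind +splitImp [G.adj_comm]
    obtain ⟨z, hz⟩ := h.exists_undominated b w
    have := h.bull x z v b a
    have := h.domino v x z w b y
    have := h.domino a w b z v x
    have := h.f1 a w b z v y
    have := h.f3 b w v x y z a
    grind +splitImp [G.adj_comm]

/-- `v w a b` is an induced path. -/
theorem IsCritical.false_of_four_path {a b v w : V} (h : IsCritical G a b v)
    (_ : G.Adj a b) (_ : G.Adj a w)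
    (_ : ¬G.Adj b w) (_ : G.Adj v w) : False := by
  have := h.not_adj_left
  have := h.not_adj_right
  have := h.ne
  obtain ⟨x, hx⟩ := h.exists_undominated b v
  have := h.bull a w x b v
  have : G.Adj a x ∧ ¬G.Adj b x ∧ ¬G.Adj v x ∧ ¬G.Adj w x := by
    grind +splitImp [G.adj_comm]
  obtain ⟨y, hy⟩ := h.exists_undominated a v
  have := h.f1 b a w y x v
  have := h.k23 a y b w x
  have : (¬G.Adj a y ∧ G.Adj b y ∧ ¬G.Adj v y ∧ G.Adj w y ∧ ¬G.Adj x y) ∨ (¬G.Adj a y ∧ G.Adj b y ∧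
      ¬G.Adj v y ∧ ¬G.Adj w y ∧ G.Adj x y) := by
    grind +splitImp [G.adj_comm]
  rcases this with this | this
  · obtain ⟨z, hz⟩ := h.exists_undominated a w
    have := h.domino w a x y b z
    have := h.f1 a b z x y v
    have := h.bull b z y a v
    have := h.f1 b a w z x v
    have := h.bull y z b w x
    grind +splitImp [G.adj_comm]
  · obtain ⟨z, hz⟩ := h.exists_undominated w y
    have := h.k23 b x a y z
    have := h.bull a b z w y
    have := h.f3 a b y x w v z
    have := h.f4 a b y x w v z
    have := h.bull a x z w y
    have := h.f1 b a w z x v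
    have := h.f1 b a w y z v
    grind +splitImp [G.adj_comm]

/-- `a b w` is a triangle and `v` is a pendant vertex at `w`. -/
theorem IsCritical.false_of_triangle_pendant {a b v w : V} (h : IsCritical G a b v)
    (_ : G.Adj a b) (_ : G.Adj a w)
    (_ : G.Adj b w) (_ : G.Adj v w) : False := by
  have := h.not_adj_left
  have := h.not_adj_right
  have := h.ne
  obtain ⟨x, hx⟩ := h.exists_undominated a v
  have := h.bull b w a x v
  have := h.diamond b w a x
  grind +splitImp [G.adj_comm]

theorem IsCritical.symm {a b v : V} (h : IsCritical G a b v) : IsCritical G b a v where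
  toIsForbiddenFree := h.toIsForbiddenFree
  ne := ⟨h.ne.1.symm, h.ne.2.2, h.ne.2.1⟩
  not_adj_left := h.not_adj_right
  not_adj_right := h.not_adj_left
  dominates u := by have := h.dominates u; tauto
  undominated := h.undominated

theorem IsCritical.false_of_adj {a b v w : V} (h : IsCritical G a b v) (hab : G.Adj a b)
    (haw : G.Adj a w) (hvw : G.Adj v w) : False := by
  by_cases hbw : G.Adj b w
  · exact h.false_of_triangle_pendant hab haw hbw hvw
  · exact h.false_of_four_path hab haw hbw hvw

theorem IsCritical.false_of_common_neighbor {a b v w x : V} (h : IsCritical G a b v)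
    (hab : ¬G.Adj a b) (haw : G.Adj a w) (hbw : ¬G.Adj b w) (hvw : G.Adj v w)
    (hax : G.Adj a x) (hbx : G.Adj b x) : False := by
  have := h.not_adj_left
  have := h.not_adj_right
  have := h.ne
  have := h.bull x w a b v
  have := h.diamond w x a v
  have hwx : ¬G.Adj w x := by grind +splitImp [G.adj_comm]
  by_cases hvx : G.Adj v x
  · exact h.false_of_square_pendant hab haw hax hbw hbx hvw hvx hwx
  · exact h.false_of_five_path hab haw hax hbw hbx hvw hvx hwx

theorem IsCritical.false_of_path {a b v w x y : V} (h : IsCritical G a b v)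
    (hab : ¬G.Adj a b) (haw : G.Adj a w) (hbw : ¬G.Adj b w) (hvw : G.Adj v w)
    (hay : G.Adj a y) (hby : ¬G.Adj b y) (hxy : G.Adj x y) (hax : ¬G.Adj a x)
    (hbx : G.Adj b x) : False := by
  have := h.not_adj_left
  have := h.not_adj_right
  have := h.ne
  by_cases hwx : G.Adj w x
  · have := h.bull w x v a b
    exact h.false_of_path_pendant hab haw hax hbw hbx hvw (by grind +splitImp [G.adj_comm]) hwx
  have := h.diamond w y a v
  have := h.bull x v y b w
  have := h.bull w y a v x
  by_cases hvx : G.Adj v x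
  · have hvy : ¬G.Adj v y := by grind +splitImp [G.adj_comm]
    by_cases hwy : G.Adj w y
    · exact h.false_of_house_pendant hab haw hax hay hbw hbx hby hvw hvx hvy hwx hwy hxy
    · exact h.false_of_pentagon_pendant hab haw hax hay hbw hbx hby hvw hvx hvy hwx hwy hxy
  · have hwy : ¬G.Adj w y := by grind +splitImp [G.adj_comm]
    by_cases hvy : G.Adj v y
    · exact h.false_of_square_tail hab haw hax hay hbw hbx hby hvw hvx hvy hwx hwy hxy
    · exact h.false_of_six_path hab haw hax hay hbw hbx hby hvw hvx hvy hwx hwy hxy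

theorem IsCritical.false_of_connected {a b v w : V} (h : IsCritical G a b v)
    (hconn : (G.induce {v}ᶜ).Connected) (haw : G.Adj a w) (hvw : G.Adj v w) : False := by
  by_cases hab : G.Adj a b
  · exact h.false_of_adj hab haw hvw
  by_cases hbw : G.Adj b w
  · exact h.false_of_claw hab haw hbw hvw
  by_cases hcommon : ∃ x, G.Adj a x ∧ G.Adj b x
  · obtain ⟨x, hax, hbx⟩ := hcommon
    exact h.false_of_common_neighbor hab haw hbw hvw hax hbx
  push Not at hcommon
  -- An edge `y x` that leaves the closed neighborhood of `a` gives the path `a y x b`. It is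
  -- taken in `G - v`, where every vertex is dominated by `a` or `b`.
  obtain ⟨p⟩ := hconn.preconnected ⟨a, h.ne.2.1⟩ ⟨b, h.ne.2.2⟩
  obtain ⟨⟨⟨⟨y, hyv⟩, ⟨x, hxv⟩⟩, hyx⟩, -, hy, hx⟩ :=
    p.exists_boundary_dart {u | u.1 = a ∨ G.Adj a u.1} (Or.inl rfl)
      (by simpa using ⟨h.ne.1.symm, hab⟩)
  replace hyx : G.Adj y x := hyx
  simp only [Set.mem_ofPred_eq, not_or] at hy hx
  simp only [Set.mem_compl_iff, Set.mem_singleton_iff] at hyv hxv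
  have hay : G.Adj a y := hy.resolve_left fun he => hx.2 (he ▸ hyx)
  have hbx : G.Adj b x := by
    have := h.dominates x
    have := hcommon y hay
    grind [G.adj_comm]
  exact h.false_of_path hab haw hbw hvw hay (hcommon y hay) hyx.symm hx.2 hbx

/-! ### Connected graphs have a dominating pair -/

theorem InducedFree.induce {W : Type*} {H : SimpleGraph W} (h : InducedFree H G) (S : Set V) :
    InducedFree H (G.induce S) :=
  fun ⟨e⟩ => h ⟨e.trans (Embedding.induce S)⟩

theorem IsForbiddenFree.induce (h : IsForbiddenFree G) (S : Set V) :
    IsForbiddenFree (G.induce S) :=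
  ⟨h.bull_free.induce S, h.diamond_free.induce S, h.k23_free.induce S, h.domino_free.induce S,
    h.p7_free.induce S, h.c7_free.induce S, h.f1_free.induce S, h.f2_free.induce S,
    h.f3_free.induce S, h.f4_free.induce S⟩

/-- Connected graphs in the class satisfy `γ ≤ 2`. The proof is by induction on the order. -/
theorem IsForbiddenFree.exists_dominating_pair {V : Type u} [Finite V] {G : SimpleGraph V}
    (h : IsForbiddenFree G) (hconn : G.Connected) :
    ∃ a b, ∀ u, u = a ∨ u = b ∨ G.Adj a u ∨ G.Adj b u := by
  induction hn : Nat.card V using Nat.strong_induction_on generalizing V with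
  | _ n ih =>
  by_contra! hcon
  rcases subsingleton_or_nontrivial V with hV | hV
  · obtain ⟨v⟩ := hconn.nonempty
    obtain ⟨u, hu, -⟩ := hcon v v
    exact hu (Subsingleton.elim u v)
  obtain ⟨v, hv⟩ := hconn.exists_connected_induce_compl_singleton_of_finite_nontrivial
  obtain ⟨⟨a, hav⟩, ⟨b, hbv⟩, hdom⟩ := ih (Nat.card ({v}ᶜ : Set V))
    (hn ▸ Finite.card_subtype_lt (x := v) (by simp)) (h.induce _) hv rfl
  simp only [Set.mem_compl_iff, Set.mem_singleton_iff] at hav hbv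
  have hdom' : ∀ u, u = a ∨ u = b ∨ u = v ∨ G.Adj a u ∨ G.Adj b u := fun u => by
    by_cases huv : u = v
    · simp [huv]
    · simpa [huv, Subtype.ext_iff] using hdom ⟨u, huv⟩
  have hcrit : IsCritical G a b v :=
    { h with
      ne := by
        refine ⟨fun hab => ?_, hav, hbv⟩
        -- If `a = b`, then `a` and `v` dominate `G`.
        obtain ⟨u, hua, huv, hau, -⟩ := hcon a v
        have := hdom' u
        grind
      not_adj_left := fun hav => by
        obtain ⟨u, hua, hub, hau, hbu⟩ := hcon a b
        have := hdom' u
        grind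
      not_adj_right := fun hbv => by
        obtain ⟨u, hua, hub, hau, hbu⟩ := hcon a b
        have := hdom' u
        grind
      dominates := hdom'
      undominated := hcon }
  obtain ⟨w, hvw⟩ := hconn.preconnected.exists_adj_of_nontrivial v
  rcases hdom' w with rfl | rfl | rfl | haw | hbw
  · exact hcrit.not_adj_left hvw.symm
  · exact hcrit.not_adj_right hvw.symm
  · exact hvw.ne rfl
  · exact hcrit.false_of_connected hv haw hvw
  · exact hcrit.symm.false_of_connected hv hbw hvw

/-! ### Weights of exponential domination -/

theorem expDecay_nonneg (d : ℕ∞) : 0 ≤ expDecay d := by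
  unfold expDecay
  split_ifs <;> positivity

theorem le_expDecay_of_le {d : ℕ∞} {n : ℕ} (h : d ≤ n) :
    (1 / 2 : ℝ) ^ ((n : ℤ) - 1) ≤ expDecay d := by
  lift d to ℕ using ne_top_of_le_ne_top (ENat.natCast_ne_top n) h
  have h' : d ≤ n := by exact_mod_cast h
  simp only [expDecay, ENat.natCast_ne_top, if_false, ENat.toNat_natCast]
  exact zpow_le_zpow_right_of_le_one₀ (by norm_num) (by norm_num) (by omega)

theorem le_one_of_one_le_expDecay {d : ℕ∞} (h : 1 ≤ expDecay d) : d ≤ 1 := by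
  rcases eq_or_ne d ⊤ with rfl | hd
  · norm_num [expDecay] at h
  lift d to ℕ using hd
  simp only [expDecay, ENat.natCast_ne_top, if_false, ENat.toNat_natCast] at h
  by_contra hd
  have hd' : 1 < d := by
    by_contra h1
    exact hd (by exact_mod_cast not_lt.1 h1)
  exact (zpow_lt_one₀ (by norm_num) (by norm_num) (by omega)).not_ge h

theorem expDecay_le_expWeight {D : Finset V} {u d : V} (hd : d ∈ D) :
    expDecay (blockedDist G D u d) ≤ expWeight G D u :=
  Finset.single_le_sum (f := fun v => expDecay (blockedDist G D u v))
    (fun _ _ => expDecay_nonneg _) hd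

theorem blockedDist_le {D : Finset V} {u v : V} {p : G.Walk u v} (hp : IsAdmissiblePath D p) :
    blockedDist G D u v ≤ p.length :=
  iInf₂_le p hp

theorem blockedDist_self_le {D : Finset V} {u : V} (hu : u ∈ D) : blockedDist G D u u ≤ 0 := by
  refine blockedDist_le (p := .nil) ⟨.nil, ⟨u, by simp [hu], by simp⟩, ?_⟩
  simp +contextual

theorem blockedDist_le_one {D : Finset V} {u d : V} (hu : u ∉ D) (hd : d ∈ D)
    (hud : G.Adj u d) : blockedDist G D u d ≤ 1 := by
  refine blockedDist_le (p := hud.toWalk) ⟨by simp [hud.ne], ⟨d, by simp [hd], ?_⟩, ?_⟩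
  · rintro x ⟨rfl | rfl, hx⟩
    exacts [absurd hx hu, rfl]
  · simp +contextual

theorem blockedDist_le_two {D : Finset V} {u m d : V} (hu : u ∉ D) (hm : m ∉ D) (hd : d ∈ D)
    (hum : G.Adj u m) (hmd : G.Adj m d) : blockedDist G D u d ≤ 2 := by
  have hne : u ≠ d := by rintro rfl; exact hu hd
  refine blockedDist_le (p := .cons hum hmd.toWalk)
    ⟨by simp [hum.ne, hmd.ne, hne], ⟨d, by simp [hd], ?_⟩, ?_⟩
  · rintro x ⟨rfl | rfl, hx⟩
    exacts [absurd hx hu, rfl]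
  · intro x hx hxu hxd
    simp [hxu, hxd] at hx
    exact hx ▸ hm

theorem reachable_of_blockedDist_ne_top {D : Finset V} {u v : V}
    (h : blockedDist G D u v ≠ ⊤) : G.Reachable u v := by
  by_contra hr
  exact h (iInf₂_eq_top.2 fun p _ => absurd p.reachable hr)

theorem eq_or_adj_of_blockedDist_le_one {D : Finset V} {u v : V}
    (h : blockedDist G D u v ≤ 1) : u = v ∨ G.Adj u v := by
  by_contra! hne
  have h2 : (2 : ℕ∞) ≤ blockedDist G D u v := by
    refine le_iInf₂ fun p _ => ?_
    match p with
    | .nil => exact absurd rfl hne.1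
    | .cons huv .nil => exact absurd huv hne.2
    | .cons _ (.cons _ q) =>
      simp only [Walk.length_cons]
      exact_mod_cast Nat.le_add_left 2 q.length
  exact absurd (h2.trans h) (by decide)

theorem one_le_expWeight_of_mem {D : Finset V} {u : V} (hu : u ∈ D) : 1 ≤ expWeight G D u := by
  have := le_expDecay_of_le (n := 0) (blockedDist_self_le (G := G) hu)
  have := expDecay_le_expWeight (G := G) (u := u) hu
  norm_num at *
  linarith

theorem one_le_expWeight_of_adj {D : Finset V} {u d : V} (hd : d ∈ D) (hud : G.Adj u d) :
    1 ≤ expWeight G D u := by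
  by_cases hu : u ∈ D
  · exact one_le_expWeight_of_mem hu
  have := le_expDecay_of_le (n := 1) (blockedDist_le_one hu hd hud)
  have := expDecay_le_expWeight (G := G) (u := u) hd
  norm_num at *
  linarith

theorem IsDominatingSet.isExpDominatingSet {D : Finset V} (h : IsDominatingSet G D) :
    IsExpDominatingSet G D := fun u => by
  by_cases hu : u ∈ D
  · exact one_le_expWeight_of_mem hu
  · obtain ⟨v, hv, huv⟩ := h u hu
    exact one_le_expWeight_of_adj hv huv

theorem expDominationNumber_le_dominationNumber [Finite V] :
    expDominationNumber G ≤ dominationNumber G := by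
  have := Fintype.ofFinite V
  have hne : {n | ∃ D : Finset V, IsDominatingSet G D ∧ D.card = n}.Nonempty :=
    ⟨_, Finset.univ, fun u hu => absurd (Finset.mem_univ u) hu, rfl⟩
  obtain ⟨D, hD, hcard⟩ := Nat.sInf_mem hne
  exact Nat.sInf_le ⟨D, hD.isExpDominatingSet, hcard⟩

/-! ### Domination and exponential domination numbers agree in the class -/

open scoped Classical in
/-- In each component, an exponential dominating set can be replaced by a dominating set of the
component that is not larger. -/
theorem IsForbiddenFree.exists_component_dominating [Finite V] (h : IsForbiddenFree G)
    {D : Finset V} (hD : IsExpDominatingSet G D) (c : G.ConnectedComponent) :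
    ∃ E : Finset V, E.card ≤ {v ∈ D | G.connectedComponentMk v = c}.card ∧
      ∀ u, G.connectedComponentMk u = c → u ∉ E → ∃ v ∈ E, G.Adj u v := by
  set Dc : Finset V := {v ∈ D | G.connectedComponentMk v = c} with hDc
  -- Only the vertices of `D` in the component of `u` contribute to the weight of `u`.
  have hweight : ∀ u, G.connectedComponentMk u = c →
      expWeight G D u = ∑ v ∈ Dc, expDecay (blockedDist G D u v) := fun u hu => by
    refine (Finset.sum_filter_of_ne fun v _ hv => ?_).symm
    rw [← hu, eq_comm, ConnectedComponent.eq]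
    refine reachable_of_blockedDist_ne_top (D := D) fun htop => hv ?_
    simp [htop, expDecay]
  have hpos : Dc.card ≠ 0 := fun h0 => by
    obtain ⟨u, hu⟩ := c.exists_rep
    have := hD u
    rw [hweight u hu, Finset.card_eq_zero.1 h0, Finset.sum_empty] at this
    norm_num at this
  rcases (Nat.one_le_iff_ne_zero.2 hpos).eq_or_lt with h1 | h2
  · refine ⟨Dc, le_rfl, fun u hu huD => ?_⟩
    obtain ⟨d, hd⟩ := Finset.card_eq_one.1 h1.symm
    have hu1 := hD u
    rw [hweight u hu, hd, Finset.sum_singleton] at hu1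
    rw [hd, Finset.mem_singleton] at huD
    exact ⟨d, by simp [hd], (eq_or_adj_of_blockedDist_le_one
      (le_one_of_one_le_expDecay hu1)).resolve_left huD⟩
  · obtain ⟨a, b, hab⟩ := (h.induce c.supp).exists_dominating_pair c.connected_toSimpleGraph
    refine ⟨{a.1, b.1}, Finset.card_le_two.trans h2, fun u hu huE => ?_⟩
    simp only [Finset.mem_insert, Finset.mem_singleton, not_or] at huE
    rcases hab ⟨u, hu⟩ with hua | hub | hau | hbu
    · exact absurd (congrArg Subtype.val hua) huE.1
    · exact absurd (congrArg Subtype.val hub) huE.2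
    · exact ⟨a, by simp, Adj.symm (G := G) hau⟩
    · exact ⟨b, by simp, Adj.symm (G := G) hbu⟩

theorem IsForbiddenFree.dominationNumber_eq [Finite V] (h : IsForbiddenFree G) :
    dominationNumber G = expDominationNumber G := by
  classical
  refine le_antisymm ?_ expDominationNumber_le_dominationNumber
  have := Fintype.ofFinite V
  have hne : {n | ∃ D : Finset V, IsExpDominatingSet G D ∧ D.card = n}.Nonempty :=
    ⟨_, Finset.univ, fun u => one_le_expWeight_of_mem (Finset.mem_univ u), rfl⟩
  obtain ⟨D, hD, hcard⟩ := Nat.sInf_mem hne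
  choose E hEcard hE using h.exists_component_dominating hD
  have hdom : IsDominatingSet G (Finset.univ.biUnion E) := fun u hu => by
    simp only [Finset.mem_biUnion, Finset.mem_univ, true_and, not_exists] at hu ⊢
    obtain ⟨v, hv, huv⟩ := hE _ u rfl (hu _)
    exact ⟨v, ⟨_, hv⟩, huv⟩
  calc dominationNumber G ≤ (Finset.univ.biUnion E).card := Nat.sInf_le ⟨_, hdom, rfl⟩
    _ ≤ ∑ c, (E c).card := Finset.card_biUnion_le
    _ ≤ ∑ c, {v ∈ D | G.connectedComponentMk v = c}.card := Finset.sum_le_sum fun c _ => hEcard c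
    _ = D.card :=
      (Finset.card_eq_sum_card_fiberwise fun _ _ => Finset.mem_coe.2 (Finset.mem_univ _)).symm
    _ = expDominationNumber G := hcard

/-! ### Graphs with two exponentially dominating vertices but no dominating pair -/

/-- Two vertices form an exponential dominating set if every vertex at distance at least two from
both is joined to each of them by a path of length two that avoids the other: it receives the weight
`1/2 + 1/2`. -/
theorem expDominationNumber_le_two {p q : V} (hpq : p ≠ q)
    (h : ∀ u, u = p ∨ u = q ∨ G.Adj u p ∨ G.Adj u q ∨
      (∃ m, m ≠ q ∧ G.Adj u m ∧ G.Adj m p) ∧ ∃ m, m ≠ p ∧ G.Adj u m ∧ G.Adj m q) :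
    expDominationNumber G ≤ 2 := by
  classical
  refine Nat.sInf_le ⟨{p, q}, fun u => ?_, Finset.card_pair hpq⟩
  by_cases hu : u ∈ ({p, q} : Finset V)
  · exact one_le_expWeight_of_mem hu
  obtain ⟨hup, huq⟩ : u ≠ p ∧ u ≠ q := by simpa using hu
  rcases h u with h | h | h | h | ⟨⟨m, hm, hum, hmp⟩, n, hn, hun, hnq⟩
  · exact absurd h hup
  · exact absurd h huq
  · exact one_le_expWeight_of_adj (by simp) h
  · exact one_le_expWeight_of_adj (by simp) h
  · have h1 := le_expDecay_of_le (n := 2) (blockedDist_le_two (D := {p, q}) hu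
      (by simp [hm, hmp.ne]) (by simp) hum hmp)
    have h2 := le_expDecay_of_le (n := 2) (blockedDist_le_two (D := {p, q}) hu
      (by simp [hn, hnq.ne]) (by simp) hun hnq)
    rw [expWeight, Finset.sum_pair hpq]
    norm_num at h1 h2
    linarith

theorem two_lt_dominationNumber [Finite V] [Nonempty V]
    (h : ∀ p q, ∃ u, u ≠ p ∧ u ≠ q ∧ ¬G.Adj u p ∧ ¬G.Adj u q) : 2 < dominationNumber G := by
  classical
  have := Fintype.ofFinite V
  have hne : {n | ∃ D : Finset V, IsDominatingSet G D ∧ D.card = n}.Nonempty :=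
    ⟨_, Finset.univ, fun u hu => absurd (Finset.mem_univ u) hu, rfl⟩
  obtain ⟨D, hD, hcard⟩ := Nat.sInf_mem hne
  by_contra! hle
  have hD2 : D.card ≤ 2 := hcard.trans_le hle
  obtain ⟨p, q, hpq⟩ : ∃ p q, ∀ x ∈ D, x = p ∨ x = q := by
    rcases D.eq_empty_or_nonempty with rfl | ⟨p, hp⟩
    · obtain ⟨p⟩ := ‹Nonempty V›
      exact ⟨p, p, by simp⟩
    · have h1 : (D.erase p).card ≤ 1 := by rw [Finset.card_erase_of_mem hp]; omega
      obtain ⟨q, hq⟩ := Finset.card_le_one_iff_subset_singleton.1 h1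
      refine ⟨p, q, fun x hx => or_iff_not_imp_left.2 fun hxp => ?_⟩
      simpa using hq (Finset.mem_erase.2 ⟨hxp, hx⟩)
  obtain ⟨u, hup, huq, hap, haq⟩ := h p q
  obtain ⟨d, hd, hud⟩ := hD u fun hu => (hpq u hu).elim hup huq
  rcases hpq d hd with rfl | rfl
  exacts [hap hud, haq hud]

/-- If `H` has no dominating pair but an exponential dominating pair `p`, `q`, then an induced copy
of `H` in `G` is an induced subgraph with `γₑ < γ`. -/
theorem inducedFree_of_forall_induce_eq [Finite V]
    (hG : ∀ S : Set V, dominationNumber (G.induce S) = expDominationNumber (G.induce S))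
    {W : Type*} {H : SimpleGraph W} (p q : W) (hpq : p ≠ q)
    (hlow : ∀ p q, ∃ u, u ≠ p ∧ u ≠ q ∧ ¬H.Adj u p ∧ ¬H.Adj u q)
    (hup : ∀ u, u = p ∨ u = q ∨ H.Adj u p ∨ H.Adj u q ∨
      (∃ m, m ≠ q ∧ H.Adj u m ∧ H.Adj m p) ∧ ∃ m, m ≠ p ∧ H.Adj u m ∧ H.Adj m q) :
    InducedFree H G := by
  rintro ⟨f⟩
  let e := f.isoInduceRange
  have : Nonempty (Set.range f) := ⟨e p⟩
  have h2 : 2 < dominationNumber (G.induce (Set.range f)) := two_lt_dominationNumber <| by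
    simpa only [e.surjective.forall, e.surjective.exists, e.map_adj_iff, e.injective.eq_iff, ne_eq]
      using hlow
  refine (hG _ ▸ h2).not_ge (expDominationNumber_le_two (e.injective.ne hpq) ?_)
  simpa only [e.surjective.forall, e.surjective.exists, e.map_adj_iff, e.injective.eq_iff, ne_eq]
    using hup

instance : DecidableRel graphF1.Adj := by unfold graphF1; infer_instance
instance : DecidableRel graphF2.Adj := by unfold graphF2; infer_instance
instance : DecidableRel graphF3.Adj := by unfold graphF3; infer_instance
instance : DecidableRel graphF4.Adj := by unfold graphF4; infer_instance
instance : DecidableRel graphF5.Adj := by unfold graphF5; infer_instance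

end

theorem theorem1 {V : Type*} [Finite V] (G : SimpleGraph V)
    (hB : InducedFree bullGraph G)
    (hD : InducedFree diamondGraph G)
    (hK4 : InducedFree (SimpleGraph.completeGraph (Fin 4)) G)
    (hK23 : InducedFree (completeBipartiteGraph (Fin 2) (Fin 3)) G)
    (hP2P3 : InducedFree ((SimpleGraph.pathGraph 2).boxProd (SimpleGraph.pathGraph 3)) G) :
    (∀ S : Set V, dominationNumber (G.induce S) = expDominationNumber (G.induce S)) ↔
      (InducedFree (SimpleGraph.pathGraph 7) G ∧
        InducedFree (SimpleGraph.cycleGraph 7) G ∧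
        InducedFree graphF1 G ∧
        InducedFree graphF2 G ∧
        InducedFree graphF3 G ∧
        InducedFree graphF4 G ∧
        InducedFree graphF5 G) := by
  constructor
  · intro h
    have hfree {n : ℕ} {H : SimpleGraph (Fin n)} := inducedFree_of_forall_induce_eq h (H := H)
    refine ⟨hfree 1 5 (by decide) ?_ ?_, hfree 0 3 (by decide) ?_ ?_,
      hfree 0 2 (by decide) (by decide) (by decide), hfree 2 5 (by decide) (by decide) (by decide),
      hfree 2 5 (by decide) (by decide) (by decide), hfree 2 5 (by decide) (by decide) (by decide),
      hfree 1 5 (by decide) (by decide) (by decide)⟩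
    · simp only [pathGraph_adj]; decide
    · simp only [pathGraph_adj]; decide
    · simp only [cycleGraph_adj']; decide
    · simp only [cycleGraph_adj']; decide
  · rintro ⟨hP7, hC7, hF1, hF2, hF3, hF4, -⟩ S
    have hG : IsForbiddenFree G := ⟨hB, hD, hK23, hP2P3, hP7, hC7, hF1, hF2, hF3, hF4⟩
    exact (hG.induce S).dominationNumber_eq
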